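/- All systems are finite-dimensional complex Hilbert spaces. A state is a positive semidefinite operator of trace one; $\rho\ll\sigma$ means $\mathrm{supp}(\rho)\subseteq\mathrm{supp}(\sigma)$; $\langle X,Y\rangle=\mathrm{Tr}[X^{*}Y]$. For $f:\mathbb{R}_{+}\to\mathbb{R}_{+}$ operator monotone let $P_f$ be its perspective function, $P_f(x,y)=y f(x/y)$ for $x,y>0$, $P_f(0,y)=y f(0^{+})$ and $P_f(x,0)=x\lim_{t\to\infty}f(t)/t$. For a state $\sigma$ with spectral decomposition $\sigma=\sum_i\lambda_iQ_i$ put $\mathbf{J}_{f,\sigma}(X)=\sum_{i,j}P_f(\lambda_i,\lambda_j)Q_iXQ_j$, and let $\mathbf{J}_{f,\sigma}^{-1}(X)=\sum_{i,j:\,P_f(\lambda_i,\lambda_j)\neq0}P_f(\lambda_i,\lambda_j)^{-1}Q_iXQ_j$ be its (pseudo)inverse. The $\chi^2_f$-divergence is $$\chi^2_f(\rho\Vert\sigma)=\langle\rho-\sigma,\mathbf{J}_{f,\sigma}^{-1}(\rho-\sigma)\rangle\ \text{ if }\rho\ll\sigma,\qquad \chi^2_f(\rho\Vert\sigma)=+\infty\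 \text{ otherwise,}$$ and for a channel $\mathcal{E}$ and a state $\sigma$ the input-dependent contraction coefficient is $$\eta_{\chi^2_f}(\mathcal{E},\sigma)=\sup_{\rho\neq\sigma}\frac{\chi^2_f(\mathcal{E}(\rho)\Vert\mathcal{E}(\sigma))}{\chi^2_f(\rho\Vert\sigma)}\in[0,\infty],$$ where $\rho$ runs over all states different from $\sigma$, a quotient with denominator $+\infty$ is $0$ (so only $\rho\ll\sigma$ contribute, which is no restriction if $\sigma$ has full rank), and the supremum of the empty set is $0$. Write $\chi^2_{GM}$ for $\chi^2_f$ with $f(x)=f_{GM}(x)=\sqrt{x}$. **Corollary** ($\eta_{\chi^2_{GM}}$ tensorizes for CPTP maps). Let $\mathcal{E}_{A_0\to B_0}$ and $\mathcal{F}_{A_1\to B_1}$ be completely positive, trace-preserving linear maps, and let $\sigma$ and $\rho$ be states of $A_0$ and $A_1$. Then $$\eta_{\chi^2_{GM}}(\mathcal{E}\otimes\mathcal{F},\sigma\otimes\rho)=\max\{\eta_{\chi^2_{GM}}(\mathcal{E},\sigma),\,\eta_{\chi^2_{GM}}(\mathcal{F},\rho)\}.$$ -/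

import Mathlib

open scoped Kronecker ComplexOrder ENNReal

noncomputable section

namespace QChi

/-! ### States and channels on finite-dimensional systems

A system `A ≅ ℂ^d` is given by a finite index type `a`; operators on it are `Matrix a a ℂ`. -/

/-- `ρ` is a quantum state (density operator): positive semidefinite with unit trace. -/
def IsState {a : Type*} [Fintype a] (ρ : Matrix a a ℂ) : Prop :=
  ρ.PosSemidef ∧ ρ.trace = 1

/-- `ρ ≪ σ`: the support of `ρ` is contained in the support of `σ`.  The support of a positive
semidefinite operator is its range. -/
def SuppLE {a : Type*} [Fintype a] (ρ σ : Matrix a a ℂ) : Prop :=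
  LinearMap.range ρ.mulVecLin ≤ LinearMap.range σ.mulVecLin

/-- The tensor product `E ⊗ F` of two linear maps between matrix spaces: the linear map with
`(E ⊗ F)(X ⊗ Y) = E(X) ⊗ F(Y)`, the matrix tensor product being the Kronecker product. -/
def tensorMap {a₀ b₀ a₁ b₁ : Type*}
    [Fintype a₀] [DecidableEq a₀] [Fintype b₀] [DecidableEq b₀]
    [Fintype a₁] [DecidableEq a₁] [Fintype b₁] [DecidableEq b₁]
    (E : Matrix a₀ a₀ ℂ →ₗ[ℂ] Matrix b₀ b₀ ℂ) (F : Matrix a₁ a₁ ℂ →ₗ[ℂ] Matrix b₁ b₁ ℂ) :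
    Matrix (a₀ × a₁) (a₀ × a₁) ℂ →ₗ[ℂ] Matrix (b₀ × b₁) (b₀ × b₁) ℂ :=
  (kroneckerLinearEquiv b₀ b₀ b₁ b₁ ℂ).toLinearMap ∘ₗ
    TensorProduct.map E F ∘ₗ
      (kroneckerLinearEquiv a₀ a₀ a₁ a₁ ℂ).symm.toLinearMap

/-- `E` is completely positive: `id_R ⊗ E` preserves positive semidefiniteness for every
ancilla `R ≅ ℂ^k`. -/
def IsCP {a b : Type*} [Fintype a] [DecidableEq a] [Fintype b] [DecidableEq b]
    (E : Matrix a a ℂ →ₗ[ℂ] Matrix b b ℂ) : Prop :=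
  ∀ (k : ℕ) (P : Matrix (Fin k × a) (Fin k × a) ℂ), P.PosSemidef →
    (tensorMap (LinearMap.id : Matrix (Fin k) (Fin k) ℂ →ₗ[ℂ] Matrix (Fin k) (Fin k) ℂ) E
      P).PosSemidef

/-- `E` is a quantum channel: completely positive and trace preserving. -/
def IsCPTP {a b : Type*} [Fintype a] [DecidableEq a] [Fintype b] [DecidableEq b]
    (E : Matrix a a ℂ →ₗ[ℂ] Matrix b b ℂ) : Prop :=
  IsCP E ∧ ∀ X, (E X).trace = X.trace

/-! ### The operators `J_{f,σ}` and the quantum `χ²`-divergences -/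

/-- The perspective function `P_f` on `[0,∞) × [0,∞)`: `y f(x/y)` for `x, y > 0`, extended by
`y f(0⁺)` at `x = 0` and by `x f'(+∞)` at `y = 0`, with `f(0⁺) = lim_{x ↓ 0} f(x)` and
`f'(+∞) = lim_{x → ∞} f(x)/x`. -/
def perspective (f : ℝ → ℝ) (x y : ℝ) : ℝ :=
  if x = 0 then y * Filter.limUnder (nhdsWithin 0 (Set.Ioi 0)) f
  else if y = 0 then x * Filter.limUnder Filter.atTop (fun t => f t / t)
  else y * f (x / y)

/-- The rank-one projector `Q_i` onto the `i`-th vector of an orthonormal eigenbasis of `σ`. -/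
def eigenProj {a : Type*} [Fintype a] [DecidableEq a] {σ : Matrix a a ℂ} (hσ : σ.IsHermitian)
    (i : a) : Matrix a a ℂ :=
  Matrix.vecMulVec (hσ.eigenvectorBasis i) (star (hσ.eigenvectorBasis i : a → ℂ))

/-- The inverse (in the pseudoinverse sense) of
`J_{f,σ}(X) = ∑_{i,j} P_f(λ_i, λ_j) Q_i X Q_j`, where `σ = ∑_i λ_i Q_i` is a spectral
decomposition: `J_{f,σ}⁻¹(X) = ∑_{i,j} P_f(λ_i, λ_j)⁻¹ Q_i X Q_j`, the terms with
`P_f(λ_i, λ_j) = 0` being omitted (here `0⁻¹ = 0`). -/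
def jInv {a : Type*} [Fintype a] [DecidableEq a] (f : ℝ → ℝ) {σ : Matrix a a ℂ}
    (hσ : σ.IsHermitian) (X : Matrix a a ℂ) : Matrix a a ℂ :=
  ∑ i, ∑ j, (((perspective f (hσ.eigenvalues i) (hσ.eigenvalues j))⁻¹ : ℝ) : ℂ) •
    (eigenProj hσ i * X * eigenProj hσ j)

/-- The Hilbert–Schmidt inner product `⟨X, Y⟩ = Tr[X^* Y]`. -/
def hsInner {a : Type*} [Fintype a] (X Y : Matrix a a ℂ) : ℂ :=
  (X.conjTranspose * Y).trace

open Classical in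
/-- The quantum `χ²_f`-divergence `χ²_f(ρ‖σ) = ⟨ρ - σ, J_{f,σ}⁻¹(ρ - σ)⟩` of states, which is a
nonnegative real number when `ρ ≪ σ`; it is `+∞` otherwise. -/
def chiSq {a : Type*} [Fintype a] [DecidableEq a] (f : ℝ → ℝ) (ρ σ : Matrix a a ℂ) : ℝ≥0∞ :=
  if h : σ.IsHermitian ∧ SuppLE ρ σ then
    ENNReal.ofReal (hsInner (ρ - σ) (jInv f h.1 (ρ - σ))).re
  else ⊤

/-- The input-dependent contraction coefficient
`η_{χ²_f}(E, σ) = sup_{ρ ≠ σ} χ²_f(E(ρ)‖E(σ)) / χ²_f(ρ‖σ)`, the supremum over states `ρ ≠ σ`.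
Division is that of `[0, ∞]`: a quotient with denominator `+∞` is `0` (also for numerator `+∞`),
so states `ρ` that are not `≪ σ` do not contribute.  The empty supremum is `0`. -/
def eta {a b : Type*} [Fintype a] [DecidableEq a] [Fintype b] [DecidableEq b] (f : ℝ → ℝ)
    (E : Matrix a a ℂ →ₗ[ℂ] Matrix b b ℂ) (σ : Matrix a a ℂ) : ℝ≥0∞ :=
  ⨆ (ρ : Matrix a a ℂ) (_ : IsState ρ ∧ ρ ≠ σ), chiSq f (E ρ) (E σ) / chiSq f ρ σ

/-- The operator monotone function of the geometric mean, `f_GM(x) = √x`. -/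
def fGM : ℝ → ℝ := Real.sqrt

end QChi

end

/-!
Since `√0 = 0` and `√t / t → 0`, the perspective of `√` is `√x √y` on the whole closed quadrant, so
`J_{GM,σ}⁻¹(X) = G X G` with `G = σ^{-1/2}` (inverse on the support) and
`χ²_GM(ω‖σ) = Tr[X^* G X G]`, `X = ω - σ`.  This is what is multiplicative under tensor products:
square roots and their pseudoinverses of `σ ⊗ ρ` are Kronecker products (`IsSqrtPair.unique`,
`IsSqrtPair.kronecker`), independently of the eigenbasis.

Write `H = σ^{1/2}` and parametrize operators supported by `σ` as `X = H Z H`.  The input and output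
divergences become the forms `N(Z) = Tr[Z^* H Z H]` (`gmForm H`) and
`M(Z) = Tr[E(HZH)^* G' E(HZH) G']` (`outForm`), where `G' = E(σ)^{-1/2}`.  States near `σ` fill out
the traceless Hermitian directions, and `Z = 1` satisfies `M(1, W) = N(1, W) = Tr[σW]`, so for
`m ≥ 0` the inequality `η(E, σ) ≤ m` is equivalent to
`M(Z) ≤ m N(Z) + (1 - m) |Tr[σZ]|²` for all complex `Z`
(`FormBound`, `eta_le_of_formBound`, `formBound_of_eta_le`).

The coefficient is at most `1` because `M ≤ N` (`outForm_self_re_le`).  Indeed `M` is represented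
with respect to `N` by the positive map `A(Z) = E†(G' E(HZH) G')` with `A(1) ≤ 1`.  Its powers
preserve `-c ≤ Z ≤ c`, so `n ↦ N(Z, Aⁿ Z)` is bounded; by Cauchy–Schwarz this sequence would grow
geometrically if `M(Z) = N(Z, A Z)` exceeded `N(Z)`.

For the tensor product, let `n`, `r`, `g` be the Gram matrices of `N`, `|Tr[σ ·]|²` and `M` on each
factor.  Those of the tensor product are their Kronecker products
(`gram_eq_submatrix_kronecker`), and with `x = m n + (1 - m) r` and `d = x - g ≥ 0`,
`m n₀⊗n₁ + (1 - m) r₀⊗r₁ - g₀⊗g₁ = x₀⊗d₁ + d₀⊗g₁ + m(1 - m) (n₀ - r₀)⊗(n₁ - r₁) ≥ 0`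
for `0 ≤ m ≤ 1`, which gives `≤` in the theorem.  The reverse inequality follows by restricting the
form bound of the tensor product to `Z ⊗ 1` and `1 ⊗ Z`.
-/

open Matrix

noncomputable section

namespace QChi

/-! ### Spectral calculus and square roots -/

section Spectral

variable {a : Type*} [Fintype a] [DecidableEq a] {σ : Matrix a a ℂ}

lemma eigenProj_mul_eigenProj (hσ : σ.IsHermitian) (i j : a) :
    eigenProj hσ i * eigenProj hσ j = if i = j then eigenProj hσ i else 0 := by
  have h := orthonormal_iff_ite.mp hσ.eigenvectorBasis.orthonormal i j
  have h' : star (hσ.eigenvectorBasis i : a → ℂ) ⬝ᵥ (hσ.eigenvectorBasis j : a → ℂ)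
      = if i = j then 1 else 0 := by
    rw [← h, EuclideanSpace.inner_eq_star_dotProduct, dotProduct_comm]
  unfold eigenProj
  rw [vecMulVec_mul_vecMulVec, h']
  split_ifs with hij
  · subst hij; simp
  · simp

lemma posSemidef_eigenProj (hσ : σ.IsHermitian) (i : a) : (eigenProj hσ i).PosSemidef :=
  posSemidef_vecMulVec_self_star _

lemma sum_smul_eigenProj (hσ : σ.IsHermitian) (c : a → ℂ) :
    ∑ i, c i • eigenProj hσ i = (hσ.eigenvectorUnitary : Matrix a a ℂ) * diagonal c *
      (star hσ.eigenvectorUnitary : Matrix a a ℂ) := by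
  ext k l
  rw [Matrix.mul_apply, Matrix.sum_apply]
  refine Finset.sum_congr rfl fun i _ => ?_
  rw [Matrix.mul_diagonal]
  simp [eigenProj, vecMulVec_apply, Matrix.star_apply, IsHermitian.eigenvectorUnitary_apply]
  ring

lemma sum_eigenProj (hσ : σ.IsHermitian) : ∑ i, eigenProj hσ i = 1 := by
  have h := sum_smul_eigenProj hσ (fun _ => 1)
  simpa using h

lemma sum_eigenvalues_smul_eigenProj (hσ : σ.IsHermitian) :
    ∑ i, (hσ.eigenvalues i : ℂ) • eigenProj hσ i = σ := by
  rw [sum_smul_eigenProj]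
  conv_rhs => rw [hσ.spectral_theorem]
  rfl

/-- The functional calculus `φ(σ) = ∑ i, φ(λ_i) Q_i` in the eigenbasis entering `jInv`. -/
def spec (hσ : σ.IsHermitian) (φ : ℝ → ℝ) : Matrix a a ℂ :=
  ∑ i, ((φ (hσ.eigenvalues i) : ℝ) : ℂ) • eigenProj hσ i

lemma spec_mul_spec (hσ : σ.IsHermitian) (φ ψ : ℝ → ℝ) :
    spec hσ φ * spec hσ ψ = spec hσ (fun t => φ t * ψ t) := by
  simp only [spec, Finset.sum_mul, Finset.mul_sum, smul_mul_smul_comm, eigenProj_mul_eigenProj]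
  simp

lemma spec_congr (hσ : σ.IsHermitian) {φ ψ : ℝ → ℝ}
    (h : ∀ i, φ (hσ.eigenvalues i) = ψ (hσ.eigenvalues i)) : spec hσ φ = spec hσ ψ := by
  simp [spec, h]

lemma spec_id (hσ : σ.IsHermitian) : spec hσ (fun t => t) = σ :=
  sum_eigenvalues_smul_eigenProj hσ

lemma posSemidef_spec (hσ : σ.IsHermitian) {φ : ℝ → ℝ}
    (h : ∀ i, 0 ≤ φ (hσ.eigenvalues i)) : (spec hσ φ).PosSemidef :=
  posSemidef_sum _ fun i _ => (posSemidef_eigenProj hσ i).smul (by exact_mod_cast h i)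

/-- Every Hermitian matrix lies between `-c` and `c` for some real `c`. -/
lemma exists_posSemidef_smul_one_sub_add (hσ : σ.IsHermitian) :
    ∃ c : ℝ, 0 ≤ c ∧ ((c : ℂ) • (1 : Matrix a a ℂ) - σ).PosSemidef ∧
      ((c : ℂ) • (1 : Matrix a a ℂ) + σ).PosSemidef := by
  have hle : ∀ i, |hσ.eigenvalues i| ≤ ∑ j, |hσ.eigenvalues j| := fun i =>
    Finset.single_le_sum (f := fun j => |hσ.eigenvalues j|) (fun j _ => abs_nonneg _)
      (Finset.mem_univ i)
  set c := ∑ j, |hσ.eigenvalues j|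
  have h1 : (c : ℂ) • (1 : Matrix a a ℂ) - σ = spec hσ (fun t => c - t) := by
    simp only [spec, Complex.ofReal_sub, sub_smul, Finset.sum_sub_distrib, ← Finset.smul_sum,
      sum_eigenProj, sum_eigenvalues_smul_eigenProj]
  have h2 : (c : ℂ) • (1 : Matrix a a ℂ) + σ = spec hσ (fun t => c + t) := by
    simp only [spec, Complex.ofReal_add, add_smul, Finset.sum_add_distrib, ← Finset.smul_sum,
      sum_eigenProj, sum_eigenvalues_smul_eigenProj]
  refine ⟨c, Finset.sum_nonneg fun j _ => abs_nonneg _, ?_, ?_⟩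
  · rw [h1]
    exact posSemidef_spec hσ fun i => sub_nonneg.mpr ((le_abs_self _).trans (hle i))
  · rw [h2]
    exact posSemidef_spec hσ fun i => by linarith [neg_abs_le (hσ.eigenvalues i), hle i]

/-- `H` is the positive square root of `σ` and `G` the Moore–Penrose inverse of `H`, that is
`H = σ^{1/2}` and `G = σ^{-1/2}` on the support of `σ`. -/
structure IsSqrtPair (σ H G : Matrix a a ℂ) : Prop where
  posH : H.PosSemidef
  posG : G.PosSemidef
  sq : H * H = σ
  comm : H * G = G * H
  hgh : H * G * H = H
  ghg : G * H * G = G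

lemma isSqrtPair_spec (hσ : σ.PosSemidef) :
    IsSqrtPair σ (spec hσ.1 Real.sqrt) (spec hσ.1 fun t => (Real.sqrt t)⁻¹) where
  posH := posSemidef_spec _ fun _ => Real.sqrt_nonneg _
  posG := posSemidef_spec _ fun _ => inv_nonneg.mpr (Real.sqrt_nonneg _)
  sq := by
    rw [spec_mul_spec]
    conv_rhs => rw [← spec_id hσ.1]
    exact spec_congr _ fun i => Real.mul_self_sqrt (hσ.eigenvalues_nonneg i)
  comm := by
    rw [spec_mul_spec, spec_mul_spec]
    exact spec_congr _ fun i => mul_comm _ _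
  hgh := by
    rw [spec_mul_spec, spec_mul_spec]
    exact spec_congr _ fun i => mul_inv_mul_cancel _
  ghg := by
    rw [spec_mul_spec, spec_mul_spec]
    exact spec_congr _ fun i => by simpa using mul_inv_mul_cancel (Real.sqrt (hσ.1.eigenvalues i))⁻¹

open scoped MatrixOrder in
lemma IsSqrtPair.unique {H G H' G' : Matrix a a ℂ} (h : IsSqrtPair σ H G)
    (h' : IsSqrtPair σ H' G') : H = H' ∧ G = G' := by
  have hH : H = H' := by
    rw [← CFC.sqrt_unique h.sq (nonneg_iff_posSemidef.mpr h.posH),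
      ← CFC.sqrt_unique h'.sq (nonneg_iff_posSemidef.mpr h'.posH)]
  subst hH
  refine ⟨rfl, ?_⟩
  -- both `G * H` and `G' * H` are the projection onto the range of `H`
  have e : G * H = G' * H := by
    calc G * H = H * G := h.comm.symm
      _ = H * G' * H * G := by rw [h'.hgh]
      _ = G' * (H * G * H) := by rw [h'.comm, mul_assoc, mul_assoc, h.comm]; simp only [mul_assoc]
                                 rw [← mul_assoc H, h.comm]; simp only [mul_assoc]
      _ = G' * H := by rw [h.hgh]
  calc G = G * H * G := h.ghg.symm
    _ = G' * (H * G) := by rw [e, mul_assoc]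
    _ = G' * (H * G') := by rw [h.comm, e, ← h'.comm]
    _ = G' := by rw [← mul_assoc, h'.ghg]

/-- The boundary values `f(0⁺)` and `f'(+∞)` of `f = √` both vanish, so the perspective function is
the geometric mean on the closed quadrant. -/
lemma perspective_fGM {x y : ℝ} (hy : 0 ≤ y) :
    perspective fGM x y = Real.sqrt x * Real.sqrt y := by
  unfold perspective
  split_ifs with h1 h2
  · have : Filter.Tendsto fGM (nhdsWithin 0 (Set.Ioi 0)) (nhds 0) := by
      have := Real.continuous_sqrt.tendsto 0
      rw [Real.sqrt_zero] at this
      exact this.mono_left nhdsWithin_le_nhds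
    rw [this.limUnder_eq]; simp [h1]
  · have : Filter.Tendsto (fun t => fGM t / t) Filter.atTop (nhds 0) := by
      have h := Real.tendsto_sqrt_atTop.inv_tendsto_atTop
      refine h.congr fun t => ?_
      simp [fGM, Real.sqrt_div_self]
    rw [this.limUnder_eq]; simp [h2]
  · have hy' : 0 < Real.sqrt y := Real.sqrt_pos.mpr (lt_of_le_of_ne hy (Ne.symm h2))
    rw [fGM, Real.sqrt_div' _ hy]
    nth_rewrite 1 [← Real.mul_self_sqrt hy]
    field_simp

lemma jInv_fGM {H G : Matrix a a ℂ} (hσ : σ.PosSemidef) (h : IsSqrtPair σ H G)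
    (X : Matrix a a ℂ) : jInv fGM hσ.1 X = G * X * G := by
  rw [(h.unique (isSqrtPair_spec hσ)).2]
  simp only [jInv, spec, Finset.sum_mul, Finset.mul_sum]
  rw [Finset.sum_comm]
  refine Finset.sum_congr rfl fun i _ => Finset.sum_congr rfl fun j _ => ?_
  rw [perspective_fGM (hσ.eigenvalues_nonneg _), mul_inv]
  simp only [smul_mul_assoc, mul_smul_comm, smul_smul, Complex.ofReal_mul]
  rw [mul_comm]

end Spectral

lemma IsSqrtPair.kronecker {a b : Type*} [Fintype a] [Fintype b]
    {σ H G : Matrix a a ℂ} {ρ H' G' : Matrix b b ℂ}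
    (h : IsSqrtPair σ H G) (h' : IsSqrtPair ρ H' G') :
    IsSqrtPair (σ ⊗ₖ ρ) (H ⊗ₖ H') (G ⊗ₖ G') where
  posH := h.posH.kronecker h'.posH
  posG := h.posG.kronecker h'.posG
  sq := by rw [← mul_kronecker_mul, h.sq, h'.sq]
  comm := by rw [← mul_kronecker_mul, ← mul_kronecker_mul, h.comm, h'.comm]
  hgh := by rw [← mul_kronecker_mul, ← mul_kronecker_mul, h.hgh, h'.hgh]
  ghg := by rw [← mul_kronecker_mul, ← mul_kronecker_mul, h.ghg, h'.ghg]

/-! ### The sesquilinear forms of the geometric mean -/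

/-- Cartesian decomposition into Hermitian parts. -/
lemma exists_eq_add_I_smul {a : Type*} (Z : Matrix a a ℂ) :
    ∃ X Y : Matrix a a ℂ, X.IsHermitian ∧ Y.IsHermitian ∧ Z = X + Complex.I • Y :=
  ⟨realPart Z, imaginaryPart Z, (realPart Z).2, (imaginaryPart Z).2,
    (realPart_add_I_smul_imaginaryPart Z).symm⟩

section Form

variable {a : Type*} [Fintype a]

/-- The sesquilinear form `(X, Y) ↦ Tr[X^* G Y G]`.  With `G = σ^{-1/2}` it is the polarization of
`χ²_GM`; with `G = σ^{1/2}` it is the same form in the coordinate `Z`, `X = σ^{1/2} Z σ^{1/2}`. -/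
def gmForm (G X Y : Matrix a a ℂ) : ℂ := (Xᴴ * G * Y * G).trace

lemma gmForm_add_left (G X X' Y : Matrix a a ℂ) :
    gmForm G (X + X') Y = gmForm G X Y + gmForm G X' Y := by
  simp [gmForm, add_mul]

lemma gmForm_add_right (G X Y Y' : Matrix a a ℂ) :
    gmForm G X (Y + Y') = gmForm G X Y + gmForm G X Y' := by
  simp [gmForm, add_mul, mul_add]

lemma gmForm_smul_left (G X Y : Matrix a a ℂ) (c : ℂ) :
    gmForm G (c • X) Y = star c * gmForm G X Y := by
  simp [gmForm]

lemma gmForm_smul_right (G X Y : Matrix a a ℂ) (c : ℂ) :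
    gmForm G X (c • Y) = c * gmForm G X Y := by
  simp [gmForm]

lemma star_gmForm {G : Matrix a a ℂ} (hG : G.IsHermitian) (X Y : Matrix a a ℂ) :
    star (gmForm G X Y) = gmForm G Y X := by
  rw [gmForm, ← trace_conjTranspose]
  simp only [conjTranspose_mul, conjTranspose_conjTranspose, hG.eq, gmForm]
  rw [trace_mul_comm]
  simp only [mul_assoc]

/-- Writing `Q = S²`, the trace is that of `S P S ≥ 0`. -/
lemma trace_mul_nonneg {P Q : Matrix a a ℂ} (hP : P.PosSemidef) (hQ : Q.PosSemidef) :
    0 ≤ (P * Q).trace := by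
  classical
  have h := isSqrtPair_spec hQ
  have h1 := (hP.mul_mul_conjTranspose_same (spec hQ.1 Real.sqrt)).trace_nonneg
  rwa [h.posH.1.eq, trace_mul_comm, ← mul_assoc, h.sq, trace_mul_comm] at h1

lemma gmForm_self_nonneg {G : Matrix a a ℂ} (hG : G.PosSemidef) (X : Matrix a a ℂ) :
    0 ≤ gmForm G X X :=
  trace_mul_nonneg (hG.conjTranspose_mul_mul_same X) hG

lemma gmForm_self_re_nonneg {G : Matrix a a ℂ} (hG : G.PosSemidef) (X : Matrix a a ℂ) :
    0 ≤ (gmForm G X X).re :=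
  (Complex.nonneg_iff.mp (gmForm_self_nonneg hG X)).1

lemma gmForm_cauchySchwarz {G : Matrix a a ℂ} (hG : G.PosSemidef) (X Y : Matrix a a ℂ) :
    (gmForm G X Y).re ^ 2 ≤ (gmForm G X X).re * (gmForm G Y Y).re := by
  have h : ∀ t : ℝ, 0 ≤ (gmForm G X X).re * (t * t) + 2 * (gmForm G X Y).re * t
      + (gmForm G Y Y).re := by
    intro t
    have h0 := gmForm_self_re_nonneg hG ((t : ℂ) • X + Y)
    have h1 : (gmForm G Y X).re = (gmForm G X Y).re := by
      rw [← star_gmForm hG.1 X Y]; simp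
    simp only [gmForm_add_left, gmForm_add_right, gmForm_smul_left, gmForm_smul_right] at h0
    simp [h1] at h0
    linarith
  have := discrim_le_zero h
  unfold discrim at this
  linarith

/-- On Hermitian matrices the form is real and symmetric, so the cross terms of `X + iY` cancel. -/
lemma gmForm_add_I_smul {X Y : Matrix a a ℂ} (G : Matrix a a ℂ) (hX : X.IsHermitian)
    (hY : Y.IsHermitian) :
    gmForm G (X + Complex.I • Y) (X + Complex.I • Y) = gmForm G X X + gmForm G Y Y := by
  have h : gmForm G X Y = gmForm G Y X := by
    rw [gmForm, gmForm, hX.eq, hY.eq, mul_assoc, trace_mul_comm]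
    simp only [mul_assoc]
  simp only [gmForm_add_left, gmForm_add_right, gmForm_smul_left, gmForm_smul_right, h]
  simp only [RCLike.star_def, Complex.conj_I]
  linear_combination (-gmForm G Y Y) * Complex.I_mul_I

end Form

/-! ### Positive trace-preserving maps -/

section Positive

variable {a b : Type*} [Fintype a]

/-- `E` is positive (not necessarily completely positive). -/
def IsPositive (E : Matrix a a ℂ →ₗ[ℂ] Matrix b b ℂ) : Prop :=
  ∀ P : Matrix a a ℂ, P.PosSemidef → (E P).PosSemidef

lemma IsPositive.map_isHermitian {E : Matrix a a ℂ →ₗ[ℂ] Matrix b b ℂ} (hE : IsPositive E)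
    {X : Matrix a a ℂ} (hX : X.IsHermitian) : (E X).IsHermitian := by
  classical
  obtain ⟨c, hc, -, h⟩ := exists_posSemidef_smul_one_sub_add hX
  have h1 := (hE _ h).1.sub
    (hE _ (PosSemidef.one.smul (show (0 : ℂ) ≤ c by exact_mod_cast hc))).1
  rwa [← map_sub, add_sub_cancel_left] at h1

lemma IsPositive.map_conjTranspose {E : Matrix a a ℂ →ₗ[ℂ] Matrix b b ℂ} (hE : IsPositive E)
    (X : Matrix a a ℂ) : E Xᴴ = (E X)ᴴ := by
  obtain ⟨Y, Z, hY, hZ, rfl⟩ := exists_eq_add_I_smul X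
  simp [hY.eq, hZ.eq, (hE.map_isHermitian hY).eq, (hE.map_isHermitian hZ).eq]

variable [Fintype b] [DecidableEq a]

/-- The adjoint of `E` for the bilinear trace pairing: `Tr[E†(Y) X] = Tr[Y E(X)]`. -/
def traceAdjoint (E : Matrix a a ℂ →ₗ[ℂ] Matrix b b ℂ) : Matrix b b ℂ →ₗ[ℂ] Matrix a a ℂ where
  toFun Y := Matrix.of fun i j => (Y * E (Matrix.single j i 1)).trace
  map_add' Y Y' := by ext; simp [add_mul]
  map_smul' c Y := by ext; simp

lemma trace_traceAdjoint_mul (E : Matrix a a ℂ →ₗ[ℂ] Matrix b b ℂ) (Y : Matrix b b ℂ)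
    (X : Matrix a a ℂ) : (traceAdjoint E Y * X).trace = (Y * E X).trace := by
  conv_rhs => rw [matrix_eq_sum_single X]
  simp only [map_sum, Finset.mul_sum, trace_sum]
  simp only [Matrix.trace, Matrix.diag_apply, Matrix.mul_apply (M := traceAdjoint E Y)]
  rw [Finset.sum_comm]
  refine Finset.sum_congr rfl fun i _ => Finset.sum_congr rfl fun j _ => ?_
  have : Matrix.single i j (X i j) = X i j • Matrix.single i j 1 := by simp
  rw [this, map_smul]
  simp [traceAdjoint, Matrix.trace, Matrix.mul_smul, Finset.mul_sum, mul_comm]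

lemma IsPositive.traceAdjoint {E : Matrix a a ℂ →ₗ[ℂ] Matrix b b ℂ} (hE : IsPositive E) :
    IsPositive (traceAdjoint E) := by
  intro P hP
  refine PosSemidef.of_dotProduct_mulVec_nonneg ?_ fun x => ?_
  · ext i j
    have h := hE.map_conjTranspose (Matrix.single i j 1)
    simp only [conjTranspose_single, star_one] at h
    simp only [QChi.traceAdjoint, LinearMap.coe_mk, AddHom.coe_mk, conjTranspose_apply, of_apply,
      ← trace_conjTranspose, conjTranspose_mul, hP.1.eq, ← h]
    exact trace_mul_comm _ _
  · have h := trace_mul_nonneg hP (hE _ (posSemidef_vecMulVec_self_star x))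
    rw [← trace_traceAdjoint_mul, mul_vecMulVec, trace_vecMulVec] at h
    rwa [dotProduct_comm]

lemma traceAdjoint_one [DecidableEq b] {E : Matrix a a ℂ →ₗ[ℂ] Matrix b b ℂ}
    (hE : ∀ X, (E X).trace = X.trace) : traceAdjoint E 1 = 1 := by
  ext i j
  simp only [traceAdjoint, LinearMap.coe_mk, AddHom.coe_mk, of_apply, one_mul, hE]
  rw [Matrix.one_apply]
  split_ifs with h
  · subst h; simp
  · exact trace_single_eq_of_ne _ _ _ (Ne.symm h)

end Positive

/-! ### Support projections -/

section Pair

variable {a : Type*} [Fintype a] {σ H G : Matrix a a ℂ}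

/-- `G * H` is the orthogonal projection onto the support of `σ`. -/
lemma IsSqrtPair.proj_mul_proj (h : IsSqrtPair σ H G) : (G * H) * (G * H) = G * H := by
  rw [← mul_assoc, h.ghg]

lemma IsSqrtPair.mul_mul_eq (h : IsSqrtPair σ H G) : G * σ * G = G * H := by
  rw [← h.sq, ← mul_assoc, mul_assoc (G * H), h.comm, h.proj_mul_proj]

lemma IsSqrtPair.mul_proj (h : IsSqrtPair σ H G) : σ * (G * H) = σ := by
  rw [← h.sq, mul_assoc, ← mul_assoc H G H, h.hgh]

lemma IsSqrtPair.proj_mul (h : IsSqrtPair σ H G) : (G * H) * σ = σ := by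
  rw [← h.sq, ← mul_assoc, ← h.comm, h.hgh]

lemma IsSqrtPair.isHermitian_proj (h : IsSqrtPair σ H G) : (G * H).IsHermitian := by
  rw [IsHermitian, conjTranspose_mul, h.posH.1.eq, h.posG.1.eq, h.comm]

lemma IsSqrtPair.posSemidef_one_sub_proj [DecidableEq a] (h : IsSqrtPair σ H G) :
    (1 - G * H).PosSemidef := by
  have h1 := posSemidef_conjTranspose_mul_self (1 - G * H)
  rwa [conjTranspose_sub, conjTranspose_one, h.isHermitian_proj.eq, sub_mul, one_mul, mul_sub,
    mul_one, h.proj_mul_proj, sub_self, sub_zero] at h1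

lemma IsSqrtPair.posSemidef (h : IsSqrtPair σ H G) : σ.PosSemidef := by
  rw [← h.sq]
  nth_rewrite 1 [← h.posH.1.eq]
  exact posSemidef_conjTranspose_mul_self H

end Pair

/-! ### Contractivity of positive trace-preserving maps -/

/-- A bounded sequence with `0 ≤ b 0` and `b n ^ 2 ≤ b 0 * b (2 n)` satisfies `b 1 ≤ b 0`:
otherwise `b (2 ^ k)` would grow at least like `(b 1 / b 0) ^ (2 ^ k)`. -/
lemma le_of_sq_le_mul_of_bounded {b : ℕ → ℝ} {K : ℝ} (h0 : 0 ≤ b 0)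
    (h : ∀ n, b n ^ 2 ≤ b 0 * b (2 * n)) (hK : ∀ n, b n ≤ K) : b 1 ≤ b 0 := by
  by_contra! hlt
  have hpos : 0 < b 0 := by
    rcases h0.eq_or_lt with h0' | h0'
    · have := h 1
      rw [← h0', zero_mul] at this
      nlinarith
    · exact h0'
  set r := b 1 / b 0 with hr
  have hr1 : 1 < r := (one_lt_div hpos).mpr hlt
  have hgrow : ∀ k : ℕ, b 0 * r ^ (2 ^ k) ≤ b (2 ^ k) := by
    intro k
    induction k with
    | zero => simp [hr, mul_div_cancel₀ _ hpos.ne']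
    | succ k ih =>
      have h1 := h (2 ^ k)
      have h2 : (b 0 * r ^ (2 ^ k)) ^ 2 ≤ b (2 ^ k) ^ 2 :=
        pow_le_pow_left₀ (by positivity) ih 2
      have h3 : b 0 * (b 0 * r ^ (2 ^ (k + 1))) ≤ b 0 * b (2 * 2 ^ k) := by
        calc b 0 * (b 0 * r ^ (2 ^ (k + 1))) = (b 0 * r ^ (2 ^ k)) ^ 2 := by
              rw [pow_succ 2 k, pow_mul]; ring
          _ ≤ _ := h2.trans h1
      rw [pow_succ' 2 k]
      rw [pow_succ' 2 k] at h3
      exact le_of_mul_le_mul_left h3 hpos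
  obtain ⟨k, hk⟩ := pow_unbounded_of_one_lt (K / b 0) hr1
  have h1 : r ^ k ≤ r ^ (2 ^ k) := pow_le_pow_right₀ hr1.le Nat.lt_two_pow_self.le
  have h2 := (hgrow k).trans (hK _)
  rw [div_lt_iff₀ hpos] at hk
  nlinarith

section Contraction

variable {a b : Type*} [Fintype a] [Fintype b]
  {E : Matrix a a ℂ →ₗ[ℂ] Matrix b b ℂ} {σ H G₀ : Matrix a a ℂ} {K G : Matrix b b ℂ}

/-- The form `(Z, W) ↦ Tr[E(HZH)^* G E(HWH) G]`: the polarized `χ²_GM` of the output of `E` in the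
coordinate `Z` of the input operator `HZH`. -/
def outForm (E : Matrix a a ℂ →ₗ[ℂ] Matrix b b ℂ) (H : Matrix a a ℂ) (G : Matrix b b ℂ)
    (Z W : Matrix a a ℂ) : ℂ :=
  gmForm G (E (H * Z * H)) (E (H * W * H))

variable [DecidableEq a]

/-- The map `Z ↦ E†(G E(HZH) G)`, which represents `outForm E H G` with respect to `gmForm H`. -/
def petzMap (E : Matrix a a ℂ →ₗ[ℂ] Matrix b b ℂ) (H : Matrix a a ℂ) (G : Matrix b b ℂ) :
    Matrix a a ℂ →ₗ[ℂ] Matrix a a ℂ where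
  toFun Z := traceAdjoint E (G * E (H * Z * H) * G)
  map_add' Z W := by simp [mul_add, add_mul]
  map_smul' c Z := by simp

lemma petzMap_apply (Z : Matrix a a ℂ) :
    petzMap E H G Z = traceAdjoint E (G * E (H * Z * H) * G) := rfl

lemma gmForm_petzMap_right (hE : IsPositive E) (hH : H.IsHermitian) (Z W : Matrix a a ℂ) :
    gmForm H Z (petzMap E H G W) = outForm E H G Z W := by
  have h1 : gmForm H Z (petzMap E H G W) = (petzMap E H G W * (H * Zᴴ * H)).trace := by
    rw [gmForm, mul_assoc, trace_mul_comm]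
    simp only [mul_assoc]
  have h2 : (H * Zᴴ * H) = (H * Z * H)ᴴ := by
    simp [conjTranspose_mul, hH.eq, mul_assoc]
  rw [h1, petzMap_apply, trace_traceAdjoint_mul, h2, hE.map_conjTranspose, outForm, gmForm,
    trace_mul_comm]
  simp only [mul_assoc]

lemma gmForm_petzMap_left (hE : IsPositive E) (hH : H.IsHermitian) (hG : G.IsHermitian)
    (Z W : Matrix a a ℂ) : gmForm H (petzMap E H G Z) W = gmForm H Z (petzMap E H G W) := by
  rw [← star_gmForm hH, gmForm_petzMap_right hE hH, gmForm_petzMap_right hE hH, outForm,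
    star_gmForm hG, outForm]

lemma gmForm_iterate_petzMap (hE : IsPositive E) (hH : H.IsHermitian) (hG : G.IsHermitian)
    (n : ℕ) (Z W : Matrix a a ℂ) :
    gmForm H ((petzMap E H G)^[n] Z) W = gmForm H Z ((petzMap E H G)^[n] W) := by
  induction n generalizing W with
  | zero => rfl
  | succ n ih =>
    rw [Function.iterate_succ_apply', gmForm_petzMap_left hE hH hG, ih, Function.iterate_succ_apply]

lemma isPositive_petzMap (hE : IsPositive E) (hH : H.IsHermitian) (hG : G.IsHermitian) :
    IsPositive (petzMap E H G) := by
  intro P hP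
  have h1 := hP.mul_mul_conjTranspose_same H
  rw [hH.eq] at h1
  have h2 := (hE _ h1).mul_mul_conjTranspose_same G
  rw [hG.eq] at h2
  exact hE.traceAdjoint _ h2

lemma petzMap_one (h : IsSqrtPair σ H G₀) (h' : IsSqrtPair (E σ) K G) :
    petzMap E H G 1 = traceAdjoint E (G * K) := by
  rw [petzMap_apply, mul_one, h.sq, h'.mul_mul_eq]

variable [DecidableEq b]

lemma posSemidef_one_sub_petzMap_one (hE : IsPositive E) (hT : ∀ X, (E X).trace = X.trace)
    (h : IsSqrtPair σ H G₀) (h' : IsSqrtPair (E σ) K G) :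
    (1 - petzMap E H G 1).PosSemidef := by
  rw [petzMap_one h h', ← traceAdjoint_one hT, ← map_sub]
  exact hE.traceAdjoint _ h'.posSemidef_one_sub_proj

/-- The output support projection is invisible to `σ`: `H E†(Π) H = σ`, as `Tr[σ E†(1 - Π)] = 0`. -/
lemma mul_petzMap_one_mul (hE : IsPositive E) (hT : ∀ X, (E X).trace = X.trace)
    (h : IsSqrtPair σ H G₀) (h' : IsSqrtPair (E σ) K G) :
    H * petzMap E H G 1 * H = σ := by
  have h1 := (posSemidef_one_sub_petzMap_one hE hT h h').mul_mul_conjTranspose_same H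
  rw [h.posH.1.eq] at h1
  have h2 : (H * (1 - petzMap E H G 1) * H).trace = 0 := by
    rw [trace_mul_comm, ← mul_assoc, h.sq, trace_mul_comm, petzMap_one h h', sub_mul, one_mul,
      trace_sub, trace_traceAdjoint_mul, h'.proj_mul, hT, sub_self]
  have h3 := h1.trace_eq_zero_iff.mp h2
  rw [mul_sub, sub_mul, mul_one, h.sq, sub_eq_zero] at h3
  exact h3.symm

/-- Positivity and `A(1) ≤ 1` preserve upper bounds `Z ≤ c` with `c ≥ 0`. -/
lemma iterate_petzMap_bounded (hE : IsPositive E) (hT : ∀ X, (E X).trace = X.trace)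
    (h : IsSqrtPair σ H G₀) (h' : IsSqrtPair (E σ) K G) {c : ℝ} (hc : 0 ≤ c) {Z : Matrix a a ℂ}
    (hZ : ((c : ℂ) • (1 : Matrix a a ℂ) - Z).PosSemidef) (n : ℕ) :
    ((c : ℂ) • (1 : Matrix a a ℂ) - (petzMap E H G)^[n] Z).PosSemidef := by
  induction n with
  | zero => exact hZ
  | succ n ih =>
    have h1 := isPositive_petzMap hE h.posH.1 h'.posG.1 _ ih
    have h2 := (posSemidef_one_sub_petzMap_one hE hT h h').smul
      (show (0 : ℂ) ≤ c by exact_mod_cast hc)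
    have h3 := h1.add h2
    rw [Function.iterate_succ_apply']
    convert h3 using 1
    rw [map_sub, map_smul, smul_sub]
    abel

lemma outForm_self_re_le_of_isHermitian (hE : IsPositive E) (hT : ∀ X, (E X).trace = X.trace)
    (h : IsSqrtPair σ H G₀) (h' : IsSqrtPair (E σ) K G) {Z : Matrix a a ℂ} (hZ : Z.IsHermitian) :
    (outForm E H G Z Z).re ≤ (gmForm H Z Z).re := by
  obtain ⟨c, hc, hc1, hc2⟩ := exists_posSemidef_smul_one_sub_add hZ
  have hH := h.posH.1
  have hb := le_of_sq_le_mul_of_bounded (b := fun n => (gmForm H Z ((petzMap E H G)^[n] Z)).re)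
    (K := c * c * σ.trace.re) (gmForm_self_re_nonneg h.posH Z) ?_ ?_
  · simpa [gmForm_petzMap_right hE hH] using hb
  · intro n
    have h1 := gmForm_cauchySchwarz h.posH Z ((petzMap E H G)^[n] Z)
    rwa [gmForm_iterate_petzMap hE hH h'.posG.1, ← Function.iterate_add_apply, ← two_mul] at h1
  · intro n
    have hW1 := iterate_petzMap_bounded hE hT h h' hc hc1 n
    have hW2 := iterate_petzMap_bounded hE hT h h' (Z := -Z) hc (by rwa [sub_neg_eq_add]) n
    rw [iterate_map_neg, sub_neg_eq_add] at hW2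
    set W := (petzMap E H G)^[n] Z
    have key : ∀ P Q : Matrix a a ℂ, P.PosSemidef → Q.PosSemidef →
        0 ≤ (P * H * Q * H).trace.re := by
      intro P Q hP hQ
      have h1 := hQ.mul_mul_conjTranspose_same H
      rw [hH.eq] at h1
      have h2 := (Complex.nonneg_iff.mp (trace_mul_nonneg hP h1)).1
      simpa only [mul_assoc] using h2
    -- add the two inequalities `Tr[(c ∓ Z) H (c ± W) H] ≥ 0`
    have h1 := key _ _ hc1 hW2
    have h2 := key _ _ hc2 hW1
    simp only [sub_mul, add_mul, mul_sub, mul_add, smul_mul_assoc, mul_smul_comm, one_mul, mul_one,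
      trace_add, trace_sub, trace_smul, h.sq] at h1 h2
    simp only [gmForm, hZ.eq]
    simp at h1 h2
    linarith

/-- Data processing for `χ²_GM` on all complex operators. -/
lemma outForm_self_re_le (hE : IsPositive E) (hT : ∀ X, (E X).trace = X.trace)
    (h : IsSqrtPair σ H G₀) (h' : IsSqrtPair (E σ) K G) (Z : Matrix a a ℂ) :
    (outForm E H G Z Z).re ≤ (gmForm H Z Z).re := by
  obtain ⟨X, Y, hX, hY, rfl⟩ := exists_eq_add_I_smul Z
  have hHX : ∀ {X : Matrix a a ℂ}, X.IsHermitian → (H * X * H).IsHermitian := fun {X} hX => by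
    have := isHermitian_mul_mul_conjTranspose H hX
    rwa [h.posH.1.eq] at this
  have e : H * (X + Complex.I • Y) * H = H * X * H + Complex.I • (H * Y * H) := by
    simp [mul_add, add_mul]
  rw [gmForm_add_I_smul H hX hY, outForm, e, map_add, map_smul,
    gmForm_add_I_smul G (hE.map_isHermitian (hHX hX)) (hE.map_isHermitian (hHX hY)),
    Complex.add_re, Complex.add_re]
  exact add_le_add (outForm_self_re_le_of_isHermitian hE hT h h' hX)
    (outForm_self_re_le_of_isHermitian hE hT h h' hY)

end Contraction

/-! ### The contraction coefficient as a bound between quadratic forms -/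

section Support

variable {a : Type*} [Fintype a] {σ H G : Matrix a a ℂ}

lemma IsSqrtPair.suppLE_iff (h : IsSqrtPair σ H G) (P : Matrix a a ℂ) :
    SuppLE P σ ↔ G * H * P = P := by
  classical
  constructor
  · intro hP
    refine Matrix.ext_of_mulVec_single fun i => ?_
    obtain ⟨w, hw⟩ := hP ⟨Pi.single i 1, rfl⟩
    simp only [mulVecLin_apply] at hw
    rw [← mulVec_mulVec, ← hw, mulVec_mulVec, h.proj_mul]
  · rintro hP _ ⟨v, rfl⟩
    refine ⟨(G * G * P) *ᵥ v, ?_⟩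
    have e : σ * (G * G * P) = P := by
      rw [← mul_assoc, ← mul_assoc, ← h.sq, mul_assoc H H G, h.comm, ← mul_assoc, h.comm,
        mul_assoc (G * H), h.comm, h.proj_mul_proj, hP]
    simp only [mulVecLin_apply, mulVec_mulVec, e]

lemma IsSqrtPair.suppLE_mul_mul (h : IsSqrtPair σ H G) (Z : Matrix a a ℂ) :
    SuppLE (H * Z * H) σ := by
  rw [h.suppLE_iff, ← mul_assoc, ← mul_assoc, ← h.comm, h.hgh]

lemma IsSqrtPair.eq_mul_mul (h : IsSqrtPair σ H G) {X : Matrix a a ℂ} (hX : X.IsHermitian)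
    (hs : SuppLE X σ) : H * (G * X * G) * H = X := by
  have h1 := (h.suppLE_iff X).mp hs
  have h2 := congrArg conjTranspose h1
  rw [conjTranspose_mul, h.isHermitian_proj.eq, hX.eq] at h2
  calc H * (G * X * G) * H = H * G * X * (G * H) := by simp only [mul_assoc]
    _ = X := by rw [h.comm, h1, h2]

lemma IsSqrtPair.gmForm_mul_mul (h : IsSqrtPair σ H G) (Z W : Matrix a a ℂ) :
    gmForm G (H * Z * H) (H * W * H) = gmForm H Z W := by
  have e : (H * Z * H)ᴴ * G * (H * W * H) * G = H * (Zᴴ * (H * G * H) * W * H * G) := by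
    simp only [conjTranspose_mul, h.posH.1.eq, mul_assoc]
  rw [gmForm, e, h.hgh, trace_mul_comm, gmForm, mul_assoc, mul_assoc _ H, ← mul_assoc H G H,
    h.hgh]

lemma chiSq_fGM_of_suppLE [DecidableEq a] (h : IsSqrtPair σ H G) {ρ : Matrix a a ℂ}
    (hs : SuppLE ρ σ) :
    chiSq fGM ρ σ = ENNReal.ofReal (gmForm G (ρ - σ) (ρ - σ)).re := by
  rw [chiSq, dif_pos ⟨h.posSemidef.1, hs⟩, jInv_fGM h.posSemidef h, hsInner, gmForm]
  simp only [mul_assoc]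

/-- A positive semidefinite `P ≤ c σ` has its support inside that of `σ`. -/
lemma IsSqrtPair.suppLE_of_posSemidef_sub [DecidableEq a] (h : IsSqrtPair σ H G)
    {P : Matrix a a ℂ} (hP : P.PosSemidef) {c : ℂ} (hc : (c • σ - P).PosSemidef) :
    SuppLE P σ := by
  have hR := h.posSemidef_one_sub_proj
  have e : c • σ * (1 - G * H) = 0 := by
    rw [smul_mul_assoc, mul_sub, mul_one, h.mul_proj, sub_self, smul_zero]
  have h0 : (P * (1 - G * H)).trace = 0 := by
    refine le_antisymm ?_ (trace_mul_nonneg hP hR)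
    have h1 := trace_mul_nonneg hc hR
    rwa [sub_mul, e, zero_sub, trace_neg, Left.nonneg_neg_iff] at h1
  obtain ⟨S, _, hS⟩ : ∃ S T, IsSqrtPair P S T := ⟨_, _, isSqrtPair_spec hP⟩
  have hRR : (1 - G * H) * (1 - G * H)ᴴ = 1 - G * H := by
    rw [hR.1.eq, sub_mul, one_mul, mul_sub, mul_one, h.proj_mul_proj, sub_self, sub_zero]
  have h2 : ((S * (1 - G * H)) * (S * (1 - G * H))ᴴ).trace = 0 := by
    rw [conjTranspose_mul, hS.posH.1.eq, mul_assoc, ← mul_assoc (1 - G * H), hRR, trace_mul_comm,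
      mul_assoc, hS.sq, trace_mul_comm, h0]
  have h3 := trace_mul_conjTranspose_self_eq_zero_iff.mp h2
  have h4 : P * (1 - G * H) = 0 := by rw [← hS.sq, mul_assoc, h3, mul_zero]
  have h5 := congrArg conjTranspose h4
  rw [conjTranspose_mul, hR.1.eq, hP.1.eq, conjTranspose_zero, sub_mul, one_mul, sub_eq_zero] at h5
  exact (h.suppLE_iff P).mpr h5.symm

end Support

section Bound

variable {a b : Type*} [Fintype a] [Fintype b]
  {E : Matrix a a ℂ →ₗ[ℂ] Matrix b b ℂ} {σ H G₀ : Matrix a a ℂ} {K G : Matrix b b ℂ} {m : ℝ}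

/-- The operator inequality `T^*T ≤ m + (1 - m) |u⟩⟨u|` between quadratic forms, where `T` is the
contraction induced by `E` and `u` its unit fixed direction `√σ`. -/
def FormBound (E : Matrix a a ℂ →ₗ[ℂ] Matrix b b ℂ) (σ H : Matrix a a ℂ) (G : Matrix b b ℂ)
    (m : ℝ) : Prop :=
  ∀ Z : Matrix a a ℂ, (outForm E H G Z Z).re
    ≤ m * (gmForm H Z Z).re + (1 - m) * Complex.normSq (σ * Z).trace

variable [DecidableEq a]

/-- Positive maps preserve `≪`, since `ω ≪ σ` forces `ω ≤ c σ`. -/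
lemma suppLE_map (hE : IsPositive E) (h : IsSqrtPair σ H G₀) (h' : IsSqrtPair (E σ) K G)
    {ω : Matrix a a ℂ} (hω : ω.PosSemidef) (hs : SuppLE ω σ) : SuppLE (E ω) (E σ) := by
  classical
  have hW := hω.mul_mul_conjTranspose_same G₀
  rw [h.posG.1.eq] at hW
  obtain ⟨c, -, hc, -⟩ := exists_posSemidef_smul_one_sub_add hW.1
  have h1 := hc.mul_mul_conjTranspose_same H
  rw [h.posH.1.eq, mul_sub, sub_mul, h.eq_mul_mul hω.1 hs, mul_smul_comm, mul_one, smul_mul_assoc,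
    h.sq] at h1
  have h2 := hE _ h1
  rw [map_sub, map_smul] at h2
  exact h'.suppLE_of_posSemidef_sub (hE _ hω) h2

variable [DecidableEq b]

lemma eta_le_of_formBound (hE : IsPositive E) (h : IsSqrtPair σ H G₀)
    (h' : IsSqrtPair (E σ) K G) (hσ : σ.trace = 1) (hm : 0 ≤ m) (hB : FormBound E σ H G m) :
    eta fGM E σ ≤ ENNReal.ofReal m := by
  refine iSup₂_le fun ω hω => ?_
  by_cases hs : SuppLE ω σ
  · have hs' := suppLE_map hE h h' hω.1.1 hs
    have hX : (ω - σ).IsHermitian := hω.1.1.1.sub h.posSemidef.1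
    have hsX : SuppLE (ω - σ) σ := by
      rw [h.suppLE_iff, mul_sub, h.proj_mul, (h.suppLE_iff ω).mp hs]
    have hZ := h.eq_mul_mul hX hsX
    set Z := G₀ * (ω - σ) * G₀
    have htr : (σ * Z).trace = 0 := by
      rw [← h.sq, mul_assoc, trace_mul_comm, hZ, trace_sub, hω.1.2, hσ, sub_self]
    have hb := hB Z
    rw [htr, map_zero, mul_zero, add_zero, outForm, hZ] at hb
    rw [chiSq_fGM_of_suppLE h' hs', chiSq_fGM_of_suppLE h hs, ← map_sub]
    refine ENNReal.div_le_of_le_mul ?_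
    rw [← ENNReal.ofReal_mul hm]
    refine ENNReal.ofReal_le_ofReal (hb.trans_eq ?_)
    rw [← h.gmForm_mul_mul, hZ]
  -- unsupported states have infinite denominator and contribute `0`, even if the numerator is `⊤`
  · have : chiSq fGM ω σ = ⊤ := dif_neg fun hc => hs hc.2
    rw [this, ENNReal.div_top]
    exact bot_le

/-- A traceless Hermitian direction supported by `σ` is realized, after rescaling, by a state. -/
lemma outForm_le_of_eta_le (h : IsSqrtPair σ H G₀) (h' : IsSqrtPair (E σ) K G)
    (hE : IsPositive E) (hσ : σ.trace = 1) (hm : 0 ≤ m) (hη : eta fGM E σ ≤ ENNReal.ofReal m)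
    {Z : Matrix a a ℂ} (hZ : Z.IsHermitian) (htr : (σ * Z).trace = 0) :
    (outForm E H G Z Z).re ≤ m * (gmForm H Z Z).re := by
  have hN := gmForm_self_re_nonneg h.posH Z
  obtain ⟨c, hc, -, hc2⟩ := exists_posSemidef_smul_one_sub_add hZ
  -- small enough for `1 + ε Z ≥ 0`, and positive also when `c = 0`
  set ε : ℝ := (c + 1)⁻¹ with hε
  have hε0 : 0 < ε := by positivity
  have hεc : (0 : ℂ) ≤ (ε : ℂ) := by exact_mod_cast hε0.le
  have hP : (1 + (ε : ℂ) • Z).PosSemidef := by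
    have h1 := (hc2.add PosSemidef.one).smul hεc
    have h2 : (ε : ℂ) * (c : ℂ) + ε = 1 := by
      rw [← mul_add_one]
      exact_mod_cast inv_mul_cancel₀ (show c + 1 ≠ 0 by positivity)
    convert h1 using 1
    rw [smul_add, smul_add, smul_smul, add_right_comm, ← add_smul, h2, one_smul]
  set ω := H * (1 + (ε : ℂ) • Z) * H with hω
  have hωσ : ω = σ + (ε : ℂ) • (H * Z * H) := by
    rw [hω, mul_add, add_mul, mul_one, h.sq, mul_smul_comm, smul_mul_assoc]
  have hsub : ω - σ = H * ((ε : ℂ) • Z) * H := by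
    rw [hωσ, add_sub_cancel_left, mul_smul_comm, smul_mul_assoc]
  have hωp : ω.PosSemidef := by
    have := hP.mul_mul_conjTranspose_same H
    rwa [h.posH.1.eq] at this
  have hst : IsState ω := by
    refine ⟨hωp, ?_⟩
    rw [hωσ, trace_add, trace_smul, mul_assoc, trace_mul_comm, mul_assoc, h.sq, trace_mul_comm,
      htr, smul_zero, add_zero, hσ]
  by_cases hne : ω = σ
  · have h0 : H * Z * H = 0 := by
      rw [hωσ, add_eq_left, smul_eq_zero] at hne
      exact hne.resolve_left (by exact_mod_cast hε0.ne')
    have : outForm E H G Z Z = 0 := by simp [outForm, gmForm, h0]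
    rw [this]
    exact mul_nonneg hm hN
  · have hs : SuppLE ω σ := h.suppLE_mul_mul _
    have h1 := (le_iSup₂ (f := fun (ρ : Matrix a a ℂ) (_ : IsState ρ ∧ ρ ≠ σ) =>
      chiSq fGM (E ρ) (E σ) / chiSq fGM ρ σ) ω ⟨hst, hne⟩).trans hη
    -- the bound is finite, so clearing the denominator is legitimate even if it vanishes
    rw [chiSq_fGM_of_suppLE h' (suppLE_map hE h h' hωp hs), chiSq_fGM_of_suppLE h hs,
      ENNReal.div_le_iff_le_mul (Or.inr ENNReal.ofReal_ne_top) (Or.inl ENNReal.ofReal_ne_top),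
      ← ENNReal.ofReal_mul hm, ← map_sub, hsub, h.gmForm_mul_mul,
      ENNReal.ofReal_le_ofReal_iff (mul_nonneg hm (gmForm_self_re_nonneg h.posH _)),
      mul_smul_comm, smul_mul_assoc, map_smul] at h1
    simp only [gmForm_smul_left, gmForm_smul_right] at h1
    simp at h1
    have h2 : 0 < ε * ε := by positivity
    rw [outForm]
    refine le_of_mul_le_mul_left ?_ h2
    linarith

lemma gmForm_one_left (h : IsSqrtPair σ H G₀) (W : Matrix a a ℂ) :
    gmForm H 1 W = (σ * W).trace := by
  rw [gmForm, conjTranspose_one, one_mul, trace_mul_comm, ← mul_assoc, h.sq]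

/-- `1` has the same pairing with `W` in the output form as in the input form. -/
lemma outForm_one_left (hE : IsPositive E) (hT : ∀ X, (E X).trace = X.trace)
    (h : IsSqrtPair σ H G₀) (h' : IsSqrtPair (E σ) K G) (W : Matrix a a ℂ) :
    outForm E H G 1 W = (σ * W).trace := by
  rw [← gmForm_petzMap_right hE h.posH.1, ← gmForm_petzMap_left hE h.posH.1 h'.posG.1, gmForm,
    (isPositive_petzMap hE h.posH.1 h'.posG.1).map_conjTranspose 1 |>.symm, conjTranspose_one,
    trace_mul_comm, ← mul_assoc, ← mul_assoc, mul_petzMap_one_mul hE hT h h']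

/-- The bound on traceless Hermitian directions extends to all complex `Z`: the fixed direction `1`
is orthogonal to them for both forms, and real and imaginary parts decouple. -/
lemma formBound_of_eta_le (hE : IsPositive E) (hT : ∀ X, (E X).trace = X.trace)
    (h : IsSqrtPair σ H G₀) (h' : IsSqrtPair (E σ) K G) (hσ : σ.trace = 1) (hm : 0 ≤ m)
    (hη : eta fGM E σ ≤ ENNReal.ofReal m) : FormBound E σ H G m := by
  have herm : ∀ {X Y : Matrix a a ℂ}, X.IsHermitian → Y.IsHermitian →
      (X * Y).trace.im = 0 := by
    intro X Y hX hY
    rw [← Complex.conj_eq_iff_im, ← RCLike.star_def, ← trace_conjTranspose, conjTranspose_mul,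
      hX.eq, hY.eq, trace_mul_comm]
  have hσh := h.posSemidef.1
  have key : ∀ Z : Matrix a a ℂ, Z.IsHermitian → (outForm E H G Z Z).re
      ≤ m * (gmForm H Z Z).re + (1 - m) * (σ * Z).trace.re ^ 2 := by
    intro Z hZ
    set t : ℝ := (σ * Z).trace.re with ht
    have htc : (σ * Z).trace = (t : ℂ) := Complex.ext (by simp [ht]) (by simp [herm hσh hZ])
    -- split off the component along the fixed direction
    obtain ⟨Y, hY⟩ : ∃ Y, Y = Z - (t : ℂ) • (1 : Matrix a a ℂ) := ⟨_, rfl⟩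
    have hYh : Y.IsHermitian := by
      rw [hY]
      refine hZ.sub ?_
      rw [IsHermitian, conjTranspose_smul, conjTranspose_one]
      simp
    have hYt : (σ * Y).trace = 0 := by
      rw [hY, mul_sub, mul_smul_comm, mul_one, trace_sub, trace_smul, hσ, htc]; simp
    have hb := outForm_le_of_eta_le h h' hE hσ hm hη hYh hYt
    have hZY : Z = (t : ℂ) • (1 : Matrix a a ℂ) + Y := by rw [hY]; abel
    have hN : gmForm H Z Z = (t : ℂ) * t + gmForm H Y Y := by
      have h1 : gmForm H Y 1 = 0 := by
        rw [← star_gmForm h.posH.1, gmForm_one_left h, hYt, star_zero]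
      rw [hZY]
      simp only [gmForm_add_left, gmForm_add_right, gmForm_smul_left, gmForm_smul_right, h1,
        gmForm_one_left h, hYt, mul_one, hσ]
      simp
    have hM : outForm E H G Z Z = (t : ℂ) * t + outForm E H G Y Y := by
      have h1 := outForm_one_left hE hT h h' Y
      have h3 := outForm_one_left hE hT h h' 1
      rw [hYt] at h1
      have h2 : outForm E H G Y 1 = 0 := by
        rw [outForm, ← star_gmForm h'.posG.1, ← outForm, h1, star_zero]
      rw [mul_one, hσ] at h3
      rw [outForm] at h1 h2 h3
      rw [hZY, outForm, outForm]
      simp only [mul_add, add_mul, mul_smul_comm, smul_mul_assoc, map_add, map_smul,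
        gmForm_add_left, gmForm_add_right, gmForm_smul_left, gmForm_smul_right, h1, h2, h3]
      simp
    rw [hN, hM]
    simp
    nlinarith
  intro Z
  obtain ⟨X, Y, hX, hY, rfl⟩ := exists_eq_add_I_smul Z
  have hHX : ∀ {X : Matrix a a ℂ}, X.IsHermitian → (H * X * H).IsHermitian := fun {X} hX => by
    have := isHermitian_mul_mul_conjTranspose H hX
    rwa [h.posH.1.eq] at this
  have e : H * (X + Complex.I • Y) * H = H * X * H + Complex.I • (H * Y * H) := by
    simp [mul_add, add_mul]
  have e2 : Complex.normSq (σ * (X + Complex.I • Y)).trace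
      = (σ * X).trace.re ^ 2 + (σ * Y).trace.re ^ 2 := by
    rw [mul_add, mul_smul_comm, trace_add, trace_smul, Complex.normSq_apply]
    simp [herm hσh hX, herm hσh hY]
    ring
  rw [gmForm_add_I_smul H hX hY, outForm, e, map_add, map_smul,
    gmForm_add_I_smul G (hE.map_isHermitian (hHX hX)) (hE.map_isHermitian (hHX hY)), e2,
    Complex.add_re, Complex.add_re]
  have h1 := key X hX
  have h2 := key Y hY
  rw [outForm] at h1 h2
  linarith

/-- Contractivity bounds the coefficient by `1`. -/
lemma eta_le_one (hE : IsPositive E) (hT : ∀ X, (E X).trace = X.trace)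
    (h : IsSqrtPair σ H G₀) (h' : IsSqrtPair (E σ) K G) (hσ : σ.trace = 1) :
    eta fGM E σ ≤ 1 := by
  rw [← ENNReal.ofReal_one]
  refine eta_le_of_formBound hE h h' hσ zero_le_one fun Z => ?_
  simpa using outForm_self_re_le hE hT h h' Z

end Bound

/-! ### Tensor products of maps -/

section Tensor

variable {a₀ b₀ a₁ b₁ : Type*}
  [Fintype a₀] [DecidableEq a₀] [Fintype b₀] [DecidableEq b₀]
  [Fintype a₁] [DecidableEq a₁] [Fintype b₁] [DecidableEq b₁]

lemma tensorMap_kronecker (E : Matrix a₀ a₀ ℂ →ₗ[ℂ] Matrix b₀ b₀ ℂ)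
    (F : Matrix a₁ a₁ ℂ →ₗ[ℂ] Matrix b₁ b₁ ℂ) (X : Matrix a₀ a₀ ℂ) (Y : Matrix a₁ a₁ ℂ) :
    tensorMap E F (X ⊗ₖ Y) = E X ⊗ₖ F Y := by
  simp [tensorMap]

/-- Linear maps that agree on Kronecker products are equal. -/
lemma ext_kronecker {M : Type*} [AddCommGroup M] [Module ℂ M]
    {S T : Matrix (a₀ × a₁) (a₀ × a₁) ℂ →ₗ[ℂ] M}
    (h : ∀ X Y, S (X ⊗ₖ Y) = T (X ⊗ₖ Y)) : S = T := by
  have : S ∘ₗ (kroneckerLinearEquiv a₀ a₀ a₁ a₁ ℂ).toLinearMap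
      = T ∘ₗ (kroneckerLinearEquiv a₀ a₀ a₁ a₁ ℂ).toLinearMap :=
    TensorProduct.ext' fun X Y => by simpa using h X Y
  refine LinearMap.ext fun P => ?_
  simpa using LinearMap.congr_fun this ((kroneckerLinearEquiv a₀ a₀ a₁ a₁ ℂ).symm P)

lemma trace_tensorMap {E : Matrix a₀ a₀ ℂ →ₗ[ℂ] Matrix b₀ b₀ ℂ}
    {F : Matrix a₁ a₁ ℂ →ₗ[ℂ] Matrix b₁ b₁ ℂ} (hE : ∀ X, (E X).trace = X.trace)
    (hF : ∀ X, (F X).trace = X.trace) (P : Matrix (a₀ × a₁) (a₀ × a₁) ℂ) :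
    (tensorMap E F P).trace = P.trace := by
  have : traceLinearMap (b₀ × b₁) ℂ ℂ ∘ₗ tensorMap E F = traceLinearMap (a₀ × a₁) ℂ ℂ :=
    ext_kronecker fun X Y => by simp [tensorMap_kronecker, trace_kronecker, hE, hF]
  exact LinearMap.congr_fun this P

lemma IsCP.isPositive {E : Matrix a₀ a₀ ℂ →ₗ[ℂ] Matrix b₀ b₀ ℂ} (hE : IsCP E) :
    IsPositive E := by
  intro P hP
  have h := (hE 1 (1 ⊗ₖ P) (PosSemidef.one.kronecker hP)).submatrix (fun i => ((0 : Fin 1), i))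
  rw [tensorMap_kronecker] at h
  convert h using 1
  ext i j
  simp [kroneckerMap_apply]

/-- Complete positivity allows any finite ancilla, not only `Fin k`. -/
lemma IsCP.isPositive_tensorMap_id_left {E : Matrix a₀ a₀ ℂ →ₗ[ℂ] Matrix b₀ b₀ ℂ} (hE : IsCP E)
    (r : Type*) [Fintype r] [DecidableEq r] :
    IsPositive (tensorMap (LinearMap.id : Matrix r r ℂ →ₗ[ℂ] Matrix r r ℂ) E) := by
  intro P hP
  let e := Fintype.equivFin r
  let ea : r × a₀ ≃ Fin (Fintype.card r) × a₀ := e.prodCongr (Equiv.refl _)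
  let eb : r × b₀ ≃ Fin (Fintype.card r) × b₀ := e.prodCongr (Equiv.refl _)
  have key : tensorMap (LinearMap.id : Matrix r r ℂ →ₗ[ℂ] Matrix r r ℂ) E
      = (reindexLinearEquiv ℂ ℂ eb.symm eb.symm).toLinearMap ∘ₗ
        tensorMap LinearMap.id E ∘ₗ (reindexLinearEquiv ℂ ℂ ea ea).toLinearMap := by
    refine ext_kronecker fun X Y => ?_
    have h1 : reindexLinearEquiv ℂ ℂ ea ea (X ⊗ₖ Y) = X.submatrix e.symm e.symm ⊗ₖ Y := by
      ext i j; rfl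
    simp only [LinearMap.comp_apply, LinearEquiv.coe_coe, h1, tensorMap_kronecker]
    ext i j
    simp [eb, kroneckerMap_apply]
  rw [key]
  exact (hE _ _ (hP.submatrix ea.symm)).submatrix eb

lemma IsCP.isPositive_tensorMap_id_right {E : Matrix a₀ a₀ ℂ →ₗ[ℂ] Matrix b₀ b₀ ℂ} (hE : IsCP E)
    (r : Type*) [Fintype r] [DecidableEq r] :
    IsPositive (tensorMap E (LinearMap.id : Matrix r r ℂ →ₗ[ℂ] Matrix r r ℂ)) := by
  intro P hP
  let ea := Equiv.prodComm a₀ r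
  let eb := Equiv.prodComm r b₀
  have key : tensorMap E (LinearMap.id : Matrix r r ℂ →ₗ[ℂ] Matrix r r ℂ)
      = (reindexLinearEquiv ℂ ℂ eb eb).toLinearMap ∘ₗ
        tensorMap LinearMap.id E ∘ₗ (reindexLinearEquiv ℂ ℂ ea ea).toLinearMap := by
    refine ext_kronecker fun X Y => ?_
    have h1 : reindexLinearEquiv ℂ ℂ ea ea (X ⊗ₖ Y) = Y ⊗ₖ X := by
      ext i j; exact mul_comm _ _
    simp only [LinearMap.comp_apply, LinearEquiv.coe_coe, h1, tensorMap_kronecker]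
    ext i j
    exact mul_comm _ _
  rw [key]
  exact (hE.isPositive_tensorMap_id_left r _ (hP.submatrix ea.symm)).submatrix eb.symm

lemma IsCP.isPositive_tensorMap {E : Matrix a₀ a₀ ℂ →ₗ[ℂ] Matrix b₀ b₀ ℂ}
    {F : Matrix a₁ a₁ ℂ →ₗ[ℂ] Matrix b₁ b₁ ℂ} (hE : IsCP E) (hF : IsCP F) :
    IsPositive (tensorMap E F) := by
  have key : tensorMap E F = tensorMap LinearMap.id F ∘ₗ tensorMap E LinearMap.id :=
    ext_kronecker fun X Y => by simp [tensorMap_kronecker]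
  intro P hP
  rw [key]
  exact hF.isPositive_tensorMap_id_left b₀ _ (hE.isPositive_tensorMap_id_right a₁ _ hP)

end Tensor

/-! ### Gram matrices of sesquilinear forms -/

section Gram

variable {a b : Type*}

/-- The Gram matrix of a sesquilinear form on `Matrix a a ℂ` in the basis of matrix units. -/
def gram [DecidableEq a] (B : Matrix a a ℂ →ₗ⋆[ℂ] Matrix a a ℂ →ₗ[ℂ] ℂ) :
    Matrix (a × a) (a × a) ℂ :=
  Matrix.of fun p q => B (Matrix.single p.1 p.2 1) (Matrix.single q.1 q.2 1)

/-- The Gram matrix of a tensor product of forms is, up to the order of the indices, the Kronecker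
product of the Gram matrices. -/
lemma gram_eq_submatrix_kronecker [DecidableEq a] [DecidableEq b]
    {B₀ : Matrix a a ℂ →ₗ⋆[ℂ] Matrix a a ℂ →ₗ[ℂ] ℂ}
    {B₁ : Matrix b b ℂ →ₗ⋆[ℂ] Matrix b b ℂ →ₗ[ℂ] ℂ}
    {B : Matrix (a × b) (a × b) ℂ →ₗ⋆[ℂ] Matrix (a × b) (a × b) ℂ →ₗ[ℂ] ℂ}
    (h : ∀ X Y X' Y', B (X ⊗ₖ Y) (X' ⊗ₖ Y') = B₀ X X' * B₁ Y Y') :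
    gram B = (gram B₀ ⊗ₖ gram B₁).submatrix (Equiv.prodProdProdComm a b a b)
      (Equiv.prodProdProdComm a b a b) := by
  ext p q
  have e : ∀ p : (a × b) × (a × b), Matrix.single p.1 p.2 (1 : ℂ)
      = Matrix.single p.1.1 p.2.1 1 ⊗ₖ Matrix.single p.1.2 p.2.2 1 := by
    intro p
    rw [single_kronecker_single, mul_one]
  simp only [gram, of_apply, submatrix_apply, kroneckerMap_apply, e, h,
    Equiv.prodProdProdComm_apply]

/-- The algebra behind tensorization: with `X = m n + (1 - m) r` and `D = X - g` on each factor,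
the defect of the tensor product is `X ⊗ D + D ⊗ g + m (1 - m) (n - r) ⊗ (n - r)`. -/
lemma posSemidef_kronecker_defect [Fintype a] [Fintype b]
    {n₀ r₀ g₀ : Matrix a a ℂ} {n₁ r₁ g₁ : Matrix b b ℂ} {m : ℝ}
    (hm : 0 ≤ m) (hm1 : m ≤ 1) (hg₀ : g₀.PosSemidef) (hg₁ : g₁.PosSemidef)
    (hn₀ : (n₀ - r₀).PosSemidef) (hn₁ : (n₁ - r₁).PosSemidef)
    (hD₀ : ((m : ℂ) • n₀ + ((1 - m : ℝ) : ℂ) • r₀ - g₀).PosSemidef)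
    (hD₁ : ((m : ℂ) • n₁ + ((1 - m : ℝ) : ℂ) • r₁ - g₁).PosSemidef) :
    ((m : ℂ) • (n₀ ⊗ₖ n₁) + ((1 - m : ℝ) : ℂ) • (r₀ ⊗ₖ r₁) - g₀ ⊗ₖ g₁).PosSemidef := by
  have h1 := ((hD₀.add hg₀).kronecker hD₁).add (hD₀.kronecker hg₁)
  have hc : (0 : ℂ) ≤ ((m * (1 - m) : ℝ) : ℂ) := by
    exact_mod_cast mul_nonneg hm (sub_nonneg.mpr hm1)
  have h2 := h1.add ((hn₀.kronecker hn₁).smul hc)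
  have e : (m : ℂ) • (n₀ ⊗ₖ n₁) + ((1 - m : ℝ) : ℂ) • (r₀ ⊗ₖ r₁) - g₀ ⊗ₖ g₁
      = ((m : ℂ) • n₀ + ((1 - m : ℝ) : ℂ) • r₀ - g₀ + g₀) ⊗ₖ
          ((m : ℂ) • n₁ + ((1 - m : ℝ) : ℂ) • r₁ - g₁)
        + ((m : ℂ) • n₀ + ((1 - m : ℝ) : ℂ) • r₀ - g₀) ⊗ₖ g₁
        + ((m * (1 - m) : ℝ) : ℂ) • ((n₀ - r₀) ⊗ₖ (n₁ - r₁)) := by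
    ext p q
    simp
    ring
  rw [e]
  exact h2

variable [Fintype a] [DecidableEq a] [Fintype b] [DecidableEq b]

lemma star_dotProduct_gram_mulVec (B : Matrix a a ℂ →ₗ⋆[ℂ] Matrix a a ℂ →ₗ[ℂ] ℂ)
    (Z : Matrix a a ℂ) :
    star (fun p : a × a => Z p.1 p.2) ⬝ᵥ gram B *ᵥ (fun p : a × a => Z p.1 p.2) = B Z Z := by
  have hZ : Z = ∑ p : a × a, Z p.1 p.2 • Matrix.single p.1 p.2 (1 : ℂ) := by
    rw [Fintype.sum_prod_type]
    conv_lhs => rw [matrix_eq_sum_single Z]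
    simp
  conv_rhs => rw [hZ]
  simp only [dotProduct, mulVec, map_sum, LinearMap.sum_apply, map_smulₛₗ, LinearMap.smul_apply,
    gram, of_apply, Pi.star_apply, Finset.mul_sum, RingHom.id_apply, smul_eq_mul]
  rw [Finset.sum_comm]
  refine Finset.sum_congr rfl fun p _ => Finset.sum_congr rfl fun q _ => ?_
  simp only [starRingEnd_apply]
  ring

lemma posSemidef_gram_iff {B : Matrix a a ℂ →ₗ⋆[ℂ] Matrix a a ℂ →ₗ[ℂ] ℂ}
    (hB : ∀ Z W, star (B Z W) = B W Z) :
    (gram B).PosSemidef ↔ ∀ Z, 0 ≤ (B Z Z).re := by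
  constructor
  · intro h Z
    have := h.re_dotProduct_nonneg (fun p => Z p.1 p.2)
    rwa [star_dotProduct_gram_mulVec] at this
  · intro h
    refine PosSemidef.of_dotProduct_mulVec_nonneg ?_ fun x => ?_
    · ext p q
      exact hB _ _
    · have h1 := star_dotProduct_gram_mulVec B (Matrix.of fun i j => x (i, j))
      simp only [of_apply, Prod.mk.eta] at h1
      rw [h1]
      refine Complex.nonneg_iff.mpr ⟨h _, ?_⟩
      exact (Complex.conj_eq_iff_im.mp (hB _ _)).symm

end Gram

/-! ### Tensorization of the form bound -/

section Forms

variable {a b : Type*} [Fintype a] [Fintype b]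

/-- `gmForm` as a bundled sesquilinear form. -/
def gmSesq (G : Matrix a a ℂ) : Matrix a a ℂ →ₗ⋆[ℂ] Matrix a a ℂ →ₗ[ℂ] ℂ :=
  LinearMap.mk₂'ₛₗ (starRingEnd ℂ) (RingHom.id ℂ) (gmForm G) (gmForm_add_left G)
    (fun c X Y => gmForm_smul_left G X Y c) (gmForm_add_right G)
    (fun c X Y => gmForm_smul_right G X Y c)

/-- `outForm` as a bundled sesquilinear form. -/
def outSesq (E : Matrix a a ℂ →ₗ[ℂ] Matrix b b ℂ) (H : Matrix a a ℂ) (G : Matrix b b ℂ) :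
    Matrix a a ℂ →ₗ⋆[ℂ] Matrix a a ℂ →ₗ[ℂ] ℂ :=
  LinearMap.mk₂'ₛₗ (starRingEnd ℂ) (RingHom.id ℂ) (outForm E H G)
    (fun X X' Y => by simp [outForm, mul_add, add_mul, gmForm_add_left])
    (fun c X Y => by simp [outForm, gmForm_smul_left])
    (fun X Y Y' => by simp [outForm, mul_add, add_mul, gmForm_add_right])
    (fun c X Y => by simp [outForm, gmForm_smul_right])

/-- The rank-one form `(Z, W) ↦ conj (Tr[σZ]) Tr[σW]`. -/
def traceSesq (σ : Matrix a a ℂ) : Matrix a a ℂ →ₗ⋆[ℂ] Matrix a a ℂ →ₗ[ℂ] ℂ :=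
  LinearMap.mk₂'ₛₗ (starRingEnd ℂ) (RingHom.id ℂ)
    (fun Z W => star (σ * Z).trace * (σ * W).trace)
    (fun X X' Y => by simp [mul_add, add_mul])
    (fun c X Y => by simp [mul_assoc])
    (fun X Y Y' => by simp [mul_add])
    (fun c X Y => by simp; ring)

lemma gmSesq_apply (G X Y : Matrix a a ℂ) : gmSesq G X Y = gmForm G X Y := rfl

lemma outSesq_apply (E : Matrix a a ℂ →ₗ[ℂ] Matrix b b ℂ) (H : Matrix a a ℂ) (G : Matrix b b ℂ)
    (X Y : Matrix a a ℂ) : outSesq E H G X Y = outForm E H G X Y := rfl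

lemma traceSesq_apply (σ Z W : Matrix a a ℂ) :
    traceSesq σ Z W = star (σ * Z).trace * (σ * W).trace := rfl

variable [DecidableEq a] {E : Matrix a a ℂ →ₗ[ℂ] Matrix b b ℂ} {σ H G₀ : Matrix a a ℂ}
  {G : Matrix b b ℂ}

lemma posSemidef_gram_outSesq (hG : G.PosSemidef) : (gram (outSesq E H G)).PosSemidef :=
  (posSemidef_gram_iff fun _ _ => star_gmForm hG.1 _ _).mpr fun _ => gmForm_self_re_nonneg hG _

/-- Cauchy–Schwarz against the fixed direction: `|Tr[σZ]|² ≤ Tr[Z^* H Z H]`. -/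
lemma posSemidef_gram_gmSesq_sub (h : IsSqrtPair σ H G₀) (hσ : σ.trace = 1) :
    (gram (gmSesq H) - gram (traceSesq σ)).PosSemidef := by
  have e : gram (gmSesq H) - gram (traceSesq σ) = gram (gmSesq H - traceSesq σ) := by
    ext; simp [gram]
  rw [e, posSemidef_gram_iff]
  · intro Z
    have h0 := gmForm_self_re_nonneg h.posH (Z + (-(σ * Z).trace) • (1 : Matrix a a ℂ))
    have h1 : gmForm H Z 1 = star (σ * Z).trace := by
      rw [← star_gmForm h.posH.1, gmForm_one_left h]
    simp only [gmForm_add_left, gmForm_add_right, gmForm_smul_left, gmForm_smul_right, h1,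
      gmForm_one_left h, mul_one, hσ] at h0
    simp only [LinearMap.sub_apply, gmSesq_apply, traceSesq_apply]
    convert h0 using 2
    simp only [star_neg]
    ring
  · intro Z W
    simp only [LinearMap.sub_apply, gmSesq_apply, traceSesq_apply, star_sub, star_gmForm h.posH.1,
      star_mul', star_star]
    ring

lemma formBound_iff_posSemidef {m : ℝ} (hH : H.IsHermitian) (hG : G.IsHermitian) :
    FormBound E σ H G m ↔ ((m : ℂ) • gram (gmSesq H) + ((1 - m : ℝ) : ℂ) • gram (traceSesq σ)
      - gram (outSesq E H G)).PosSemidef := by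
  have e : (m : ℂ) • gram (gmSesq H) + ((1 - m : ℝ) : ℂ) • gram (traceSesq σ)
      - gram (outSesq E H G)
      = gram ((m : ℂ) • gmSesq H + ((1 - m : ℝ) : ℂ) • traceSesq σ - outSesq E H G) := by
    ext; simp [gram]
  rw [e, posSemidef_gram_iff]
  · refine forall_congr' fun Z => ?_
    have : star (σ * Z).trace * (σ * Z).trace = ((Complex.normSq (σ * Z).trace : ℝ) : ℂ) :=
      Complex.normSq_eq_conj_mul_self.symm
    simp only [LinearMap.sub_apply, LinearMap.add_apply, LinearMap.smul_apply, gmSesq_apply,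
      traceSesq_apply, outSesq_apply, smul_eq_mul, Complex.sub_re, Complex.add_re,
      Complex.re_ofReal_mul, this, Complex.ofReal_re, sub_nonneg]
  · intro Z W
    simp only [LinearMap.sub_apply, LinearMap.add_apply, LinearMap.smul_apply, gmSesq_apply,
      traceSesq_apply, outSesq_apply, smul_eq_mul, outForm, star_sub, star_add, star_mul',
      star_gmForm hH, star_gmForm hG, RCLike.star_def, Complex.conj_ofReal,
      Complex.conj_conj]
    ring

end Forms

section TensorForms

lemma gmForm_kronecker {a b : Type*} [Fintype a] [Fintype b] (G X X' : Matrix a a ℂ)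
    (G' Y Y' : Matrix b b ℂ) :
    gmForm (G ⊗ₖ G') (X ⊗ₖ Y) (X' ⊗ₖ Y') = gmForm G X X' * gmForm G' Y Y' := by
  simp only [gmForm, conjTranspose_kronecker, ← mul_kronecker_mul, trace_kronecker]

variable {a₀ b₀ a₁ b₁ : Type*}
  [Fintype a₀] [DecidableEq a₀] [Fintype b₀] [DecidableEq b₀]
  [Fintype a₁] [DecidableEq a₁] [Fintype b₁] [DecidableEq b₁]
  {E : Matrix a₀ a₀ ℂ →ₗ[ℂ] Matrix b₀ b₀ ℂ} {F : Matrix a₁ a₁ ℂ →ₗ[ℂ] Matrix b₁ b₁ ℂ}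
  {σ H₀ J₀ : Matrix a₀ a₀ ℂ} {ρ H₁ J₁ : Matrix a₁ a₁ ℂ} {K₀ G₀ : Matrix b₀ b₀ ℂ}
  {K₁ G₁ : Matrix b₁ b₁ ℂ} {m : ℝ}

/-- This multiplicativity is special to the geometric mean. -/
lemma outForm_tensorMap (X X' : Matrix a₀ a₀ ℂ) (Y Y' : Matrix a₁ a₁ ℂ) :
    outForm (tensorMap E F) (H₀ ⊗ₖ H₁) (G₀ ⊗ₖ G₁) (X ⊗ₖ Y) (X' ⊗ₖ Y')
      = outForm E H₀ G₀ X X' * outForm F H₁ G₁ Y Y' := by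
  simp only [outForm, ← mul_kronecker_mul, tensorMap_kronecker, gmForm_kronecker]

lemma FormBound.tensorMap (h₀ : IsSqrtPair σ H₀ J₀) (h₁ : IsSqrtPair ρ H₁ J₁)
    (hG₀ : G₀.PosSemidef) (hG₁ : G₁.PosSemidef) (hσ : σ.trace = 1) (hρ : ρ.trace = 1)
    (hm : 0 ≤ m) (hm1 : m ≤ 1) (hE : FormBound E σ H₀ G₀ m) (hF : FormBound F ρ H₁ G₁ m) :
    FormBound (QChi.tensorMap E F) (σ ⊗ₖ ρ) (H₀ ⊗ₖ H₁) (G₀ ⊗ₖ G₁) m := by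
  rw [formBound_iff_posSemidef h₀.posH.1 hG₀.1] at hE
  rw [formBound_iff_posSemidef h₁.posH.1 hG₁.1] at hF
  rw [formBound_iff_posSemidef (h₀.posH.kronecker h₁.posH).1 (hG₀.kronecker hG₁).1,
    gram_eq_submatrix_kronecker (B₀ := gmSesq H₀) (B₁ := gmSesq H₁) (B := gmSesq (H₀ ⊗ₖ H₁))
      fun X Y X' Y' => gmForm_kronecker _ _ _ _ _ _,
    gram_eq_submatrix_kronecker (B₀ := outSesq E H₀ G₀) (B₁ := outSesq F H₁ G₁)
      (B := outSesq (QChi.tensorMap E F) (H₀ ⊗ₖ H₁) (G₀ ⊗ₖ G₁))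
      fun X Y X' Y' => outForm_tensorMap _ _ _ _,
    gram_eq_submatrix_kronecker (B₀ := traceSesq σ) (B₁ := traceSesq ρ)
      (B := traceSesq (σ ⊗ₖ ρ)) fun X Y X' Y' => by
      simp only [traceSesq_apply, ← mul_kronecker_mul, trace_kronecker, star_mul']
      ring]
  exact (posSemidef_kronecker_defect hm hm1 (posSemidef_gram_outSesq hG₀)
    (posSemidef_gram_outSesq hG₁) (posSemidef_gram_gmSesq_sub h₀ hσ)
    (posSemidef_gram_gmSesq_sub h₁ hρ) hE hF).submatrix _

/-- Restrict the tensor form to operators `Z ⊗ 1`. -/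
lemma FormBound.left (h₁ : IsSqrtPair ρ H₁ J₁) (h₁' : IsSqrtPair (F ρ) K₁ G₁)
    (hF : IsPositive F) (hT : ∀ X, (F X).trace = X.trace) (hρ : ρ.trace = 1)
    (h : FormBound (QChi.tensorMap E F) (σ ⊗ₖ ρ) (H₀ ⊗ₖ H₁) (G₀ ⊗ₖ G₁) m) :
    FormBound E σ H₀ G₀ m := by
  intro Z
  have h2 := h (Z ⊗ₖ 1)
  rwa [outForm_tensorMap, gmForm_kronecker, outForm_one_left hF hT h₁ h₁', gmForm_one_left h₁,
    ← mul_kronecker_mul, trace_kronecker, mul_one ρ, hρ, mul_one, mul_one, mul_one] at h2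

lemma FormBound.right (h₀ : IsSqrtPair σ H₀ J₀) (h₀' : IsSqrtPair (E σ) K₀ G₀)
    (hE : IsPositive E) (hT : ∀ X, (E X).trace = X.trace) (hσ : σ.trace = 1)
    (h : FormBound (QChi.tensorMap E F) (σ ⊗ₖ ρ) (H₀ ⊗ₖ H₁) (G₀ ⊗ₖ G₁) m) :
    FormBound F ρ H₁ G₁ m := by
  intro Z
  have h2 := h (1 ⊗ₖ Z)
  rwa [outForm_tensorMap, gmForm_kronecker, outForm_one_left hE hT h₀ h₀', gmForm_one_left h₀,
    ← mul_kronecker_mul, trace_kronecker, mul_one σ, hσ, one_mul, one_mul, one_mul] at h2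

end TensorForms

end QChi

end

theorem mainTheorem9 {a₀ b₀ a₁ b₁ : Type*}
    [Fintype a₀] [DecidableEq a₀] [Fintype b₀] [DecidableEq b₀]
    [Fintype a₁] [DecidableEq a₁] [Fintype b₁] [DecidableEq b₁]
    (E : Matrix a₀ a₀ ℂ →ₗ[ℂ] Matrix b₀ b₀ ℂ) (F : Matrix a₁ a₁ ℂ →ₗ[ℂ] Matrix b₁ b₁ ℂ)
    (hE : QChi.IsCPTP E) (hF : QChi.IsCPTP F)
    (σ : Matrix a₀ a₀ ℂ) (ρ : Matrix a₁ a₁ ℂ)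
    (hσ : QChi.IsState σ) (hρ : QChi.IsState ρ) :
    QChi.eta QChi.fGM (QChi.tensorMap E F) (σ ⊗ₖ ρ)
      = max (QChi.eta QChi.fGM E σ) (QChi.eta QChi.fGM F ρ) := by
  have hEp := hE.1.isPositive
  have hFp := hF.1.isPositive
  have hEFp := hE.1.isPositive_tensorMap hF.1
  have hEFt := QChi.trace_tensorMap hE.2 hF.2
  have h₀ := QChi.isSqrtPair_spec hσ.1
  have h₁ := QChi.isSqrtPair_spec hρ.1
  have h₀' := QChi.isSqrtPair_spec (hEp _ hσ.1)
  have h₁' := QChi.isSqrtPair_spec (hFp _ hρ.1)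
  have h := h₀.kronecker h₁
  have h' := h₀'.kronecker h₁'
  rw [← QChi.tensorMap_kronecker] at h'
  have htr : (σ ⊗ₖ ρ).trace = 1 := by
    rw [Matrix.trace_kronecker, hσ.2, hρ.2, mul_one]
  refine le_antisymm ?_ ?_
  · set M := max (QChi.eta QChi.fGM E σ) (QChi.eta QChi.fGM F ρ) with hM
    have hM1 : M ≤ 1 := max_le (QChi.eta_le_one hEp hE.2 h₀ h₀' hσ.2)
      (QChi.eta_le_one hFp hF.2 h₁ h₁' hρ.2)
    have hMt : ENNReal.ofReal M.toReal = M :=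
      ENNReal.ofReal_toReal (hM1.trans_lt ENNReal.one_lt_top).ne
    have hm1 : M.toReal ≤ 1 := ENNReal.toReal_le_of_le_ofReal zero_le_one (by simpa using hM1)
    rw [← hMt]
    refine QChi.eta_le_of_formBound hEFp h h' htr ENNReal.toReal_nonneg ?_
    exact QChi.FormBound.tensorMap h₀ h₁ h₀'.posG h₁'.posG hσ.2 hρ.2 ENNReal.toReal_nonneg hm1
      (QChi.formBound_of_eta_le hEp hE.2 h₀ h₀' hσ.2 ENNReal.toReal_nonneg
        (hMt.symm ▸ le_max_left _ _))
      (QChi.formBound_of_eta_le hFp hF.2 h₁ h₁' hρ.2 ENNReal.toReal_nonneg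
        (hMt.symm ▸ le_max_right _ _))
  · set M := QChi.eta QChi.fGM (QChi.tensorMap E F) (σ ⊗ₖ ρ) with hM
    have hMt : ENNReal.ofReal M.toReal = M := ENNReal.ofReal_toReal
      ((QChi.eta_le_one hEFp hEFt h h' htr).trans_lt ENNReal.one_lt_top).ne
    have hB := QChi.formBound_of_eta_le hEFp hEFt h h' htr ENNReal.toReal_nonneg
      (hM ▸ hMt.symm.le)
    rw [← hMt]
    exact max_le
      (QChi.eta_le_of_formBound hEp h₀ h₀' hσ.2 ENNReal.toReal_nonneg
        (hB.left h₁ h₁' hFp hF.2 hρ.2))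
      (QChi.eta_le_of_formBound hFp h₁ h₁' hρ.2 ENNReal.toReal_nonneg
        (hB.right h₀ h₀' hEp hE.2 hσ.2))
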